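/- Let $\theta\in(0,\pi/2)$ with $\theta\neq\pi/4$, and let $|\psi(\theta)\rangle_{AB}=\cos\theta\,|00\rangle+\sin\theta\,|11\rangle$ be shared by Alice (qubit $A$) and Bob (qubit $B$). (a) Perfect deterministic teleportation of an arbitrary qubit state is impossible using $|\psi(\theta)\rangle_{AB}$ as the only shared bipartite resource. That is, let Alice hold an input qubit $Q$ in state $\rho$ and the qubit $A$, and let Bob hold $B$. A (finite-round) LOCC protocol consists of finitely many rounds in which one party applies a trace-preserving local quantum instrument (finitely many outcomes, finite-dimensional registers, local ancillas allowed), which may depend on all earlier outcomes, and communicates the outcome to the other party; at the end Bob holds one qubit and Alice's system is discarded. Then there is no LOCC protocol for which there is a fixed unitary $U\in U(2)$ such that for every qubit density operator $\rho$, starting from $\rho_Q\otimes|\psi(\theta)\rangle\langle\psi(\theta)|_{AB}$, Bob's output (averaged over all outcomes) is $U\rho U^\dagger$. (b) For the standard protocol (Alice measures $QA$ in the Bell basis $(\mathbb I\otimes\sigma_m)(|00\rangle+|11\rangle)/\sqrt2$, $\sigma_m\in\{\mathbb I,\sigma_x,\sigma_y,\sigma_z\}$, and Bob applies the correction $\sigma_m$),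 the induced channel maps the state $\tfrac12(\mathbb I+\vec v\cdot\vec\sigma)$, $\|\vec v\|\le1$, to the state with Bloch vector $\mathrm{diag}(\sin2\theta,\sin2\theta,1)\,\vec v$. The image of the Bloch ball is the prolate spheroid $$\Bigl\{\vec w\in\mathbb R^3:\ \frac{w_x^2}{\sin^2 2\theta}+\frac{w_y^2}{\sin^2 2\theta}+w_z^2\le 1\Bigr\},\qquad 0<\sin 2\theta<1 .$$ -/

import Mathlib

open scoped Matrix Kronecker ComplexOrder

noncomputable section

namespace Teleportation

/-- A density operator on the finite-dimensional space `ℂ^α`. -/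
def IsDensity {α : Type} [Fintype α] (ρ : Matrix α α ℂ) : Prop :=
  ρ.PosSemidef ∧ ρ.trace = 1

/-- The partial trace over the left (Alice's) tensor factor. -/
def traceLeft {α β : Type} [Fintype α] (ρ : Matrix (α × β) (α × β) ℂ) : Matrix β β ℂ :=
  fun y y' => ∑ x, ρ (x, y) (x, y')

/-- Finite-round LOCC protocols in which Alice starts with a register `ℂ^α`, Bob starts with a
register `ℂ^β`, and at the end Bob holds a register `ℂ^δ` while whatever is left on Alice's side
is discarded.

In each round one party applies a local quantum instrument with classical outcome `i : ι`, whose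
`i`-th completely positive branch has the Kraus operators `K i k`, `k : κ`. Completeness says that
the instrument is trace preserving, so the protocol is deterministic. The outcome is sent
to the other party, and the rest of the protocol may depend on it. The dimension of the register
may change, so that attaching a local ancilla, discarding local subsystems, local unitaries,
local measurements and public randomness are all instances of such a round. -/
inductive LOCC (δ : Type) : (α β : Type) → [Fintype α] → [DecidableEq α] →
    [Fintype β] → [DecidableEq β] → Type 1
  | done {α : Type} [Fintype α] [DecidableEq α] [Fintype δ] [DecidableEq δ] : LOCC δ α δ
  | alice {α β : Type} [Fintype α] [DecidableEq α] [Fintype β] [DecidableEq β]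
      (ι κ α' : Type) [Fintype ι] [Fintype κ] [Fintype α'] [DecidableEq α']
      (K : ι → κ → Matrix α' α ℂ) (complete : ∑ i, ∑ k, (K i k)ᴴ * K i k = 1)
      (next : ι → LOCC δ α' β) : LOCC δ α β
  | bob {α β : Type} [Fintype α] [DecidableEq α] [Fintype β] [DecidableEq β]
      (ι κ β' : Type) [Fintype ι] [Fintype κ] [Fintype β'] [DecidableEq β']
      (K : ι → κ → Matrix β' β ℂ) (complete : ∑ i, ∑ k, (K i k)ᴴ * K i k = 1)
      (next : ι → LOCC δ α β') : LOCC δ α β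

/-- Bob's final state, averaged over all classical outcomes, when the protocol is run on the
joint state `ρ` of Alice and Bob. -/
def LOCC.run {δ : Type} : {α β : Type} → [Fintype α] → [DecidableEq α] →
    [Fintype β] → [DecidableEq β] → LOCC δ α β → Matrix (α × β) (α × β) ℂ → Matrix δ δ ℂ
  | _, _, _, _, _, _, @LOCC.done _ _ _ _ _ _, ρ => traceLeft ρ
  | _, β, _, _, _, _, @LOCC.alice _ _ _ _ _ _ _ _ _ _ _ _ _ _ K _ next, ρ =>
      ∑ i, (next i).run
        (∑ k, (K i k ⊗ₖ (1 : Matrix β β ℂ)) * ρ * (K i k ⊗ₖ (1 : Matrix β β ℂ))ᴴ)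
  | α, _, _, _, _, _, @LOCC.bob _ _ _ _ _ _ _ _ _ _ _ _ _ _ K _ next, ρ =>
      ∑ i, (next i).run
        (∑ k, ((1 : Matrix α α ℂ) ⊗ₖ K i k) * ρ * ((1 : Matrix α α ℂ) ⊗ₖ K i k)ᴴ)

/-- The two-qubit vector `cos θ |00⟩ + sin θ |11⟩`. -/
def resource (θ : ℝ) : Fin 2 × Fin 2 → ℂ := fun p =>
  if p = (0, 0) then (Real.cos θ : ℂ) else if p = (1, 1) then (Real.sin θ : ℂ) else 0

/-- The projector `|ψ⟩⟨ψ|`. -/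
def ketbra {α : Type} (ψ : α → ℂ) : Matrix α α ℂ := Matrix.vecMulVec ψ (star ψ)

/-- The initial state `ρ_Q ⊗ |ψ⟩⟨ψ|_{AB}`, viewed across the cut `QA | B`: Alice holds the input
qubit `Q` and the half `A` of the resource, Bob holds the half `B`. -/
def initialState (ψ : Fin 2 × Fin 2 → ℂ) (ρ : Matrix (Fin 2) (Fin 2) ℂ) :
    Matrix ((Fin 2 × Fin 2) × Fin 2) ((Fin 2 × Fin 2) × Fin 2) ℂ :=
  (ρ ⊗ₖ ketbra ψ).submatrix (Equiv.prodAssoc _ _ _) (Equiv.prodAssoc _ _ _)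

/-- The map from the input qubit to Bob's output qubit that an LOCC protocol induces
when the only shared resource is the pure state `ψ` of `AB`. -/
def inducedChannel (P : LOCC (Fin 2) (Fin 2 × Fin 2) (Fin 2)) (ψ : Fin 2 × Fin 2 → ℂ)
    (ρ : Matrix (Fin 2) (Fin 2) ℂ) : Matrix (Fin 2) (Fin 2) ℂ :=
  P.run (initialState ψ ρ)

/-- A qubit map is a perfect teleportation if for every input state the output equals the input
up to a fixed unitary, the same for all inputs. -/
def IsPerfectTeleportation (E : Matrix (Fin 2) (Fin 2) ℂ → Matrix (Fin 2) (Fin 2) ℂ) : Prop :=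
  ∃ U ∈ Matrix.unitaryGroup (Fin 2) ℂ, ∀ ρ, IsDensity ρ → E ρ = U * ρ * Uᴴ

/-- The Pauli matrices `σ_x, σ_y, σ_z`. -/
def pauli : Fin 3 → Matrix (Fin 2) (Fin 2) ℂ :=
  ![!![0, 1; 1, 0], !![0, -Complex.I; Complex.I, 0], !![1, 0; 0, -1]]

/-- The matrices `1, σ_x, σ_y, σ_z`. -/
def pauli4 : Fin 4 → Matrix (Fin 2) (Fin 2) ℂ := Fin.cons 1 pauli

/-- The Bell basis `(1 ⊗ σ_m)(|00⟩ + |11⟩)/√2` of the two qubits `QA`. -/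
def bell (m : Fin 4) : Fin 2 × Fin 2 → ℂ := fun p => pauli4 m p.2 p.1 / (Real.sqrt 2 : ℂ)

/-- `⟨φ_m|` for the `m`-th Bell vector, as a one-row matrix. -/
def bellBra (m : Fin 4) : Matrix Unit (Fin 2 × Fin 2) ℂ := fun _ p => star (bell m p)

theorem bellBra_complete :
    ∑ m : Fin 4, ∑ _k : Unit, (bellBra m)ᴴ * bellBra m = 1 := by
  have h : (Real.sqrt 2 : ℂ) * (Real.sqrt 2 : ℂ) = 2 := by
    rw [← Complex.ofReal_mul, Real.mul_self_sqrt (by norm_num)]; norm_num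
  have h2 : (Real.sqrt 2 : ℂ)⁻¹ * (Real.sqrt 2 : ℂ)⁻¹ = 1 / 2 := by
    rw [← mul_inv, h]; norm_num
  have h3 (z w : ℂ) : z * (Real.sqrt 2 : ℂ)⁻¹ * (w * (Real.sqrt 2 : ℂ)⁻¹) = z * w / 2 := by
    rw [mul_mul_mul_comm, h2]; ring
  ext ⟨a, b⟩ ⟨c, d⟩
  simp only [Matrix.sum_apply, Matrix.mul_apply, Matrix.conjTranspose_apply, bellBra, bell,
    div_eq_mul_inv, star_mul', star_inv₀, Complex.star_def, Complex.conj_ofReal,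
    Finset.univ_unique, Finset.sum_singleton, h3]
  fin_cases a <;> fin_cases b <;> fin_cases c <;> fin_cases d <;>
    simp [pauli4, pauli, Fin.sum_univ_succ] <;> norm_num

theorem pauli4_complete (m : Fin 4) :
    ∑ _i : Unit, ∑ _k : Unit, (pauli4 m)ᴴ * pauli4 m = 1 := by
  ext a b
  fin_cases m <;> fin_cases a <;> fin_cases b <;>
    simp [pauli4, pauli, Matrix.mul_apply, Fin.sum_univ_succ]

/-- The standard teleportation protocol: Alice measures `QA` in the Bell basis, sends the outcome
`m`, and Bob applies the Pauli correction `σ_m`. -/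
def standardProtocol : LOCC (Fin 2) (Fin 2 × Fin 2) (Fin 2) :=
  .alice (Fin 4) Unit Unit (fun m _ => bellBra m) bellBra_complete fun m =>
    .bob Unit Unit (Fin 2) (fun _ _ => pauli4 m) (pauli4_complete m) fun _ => .done

/-- The operator `(1 + v · σ) / 2` with Bloch vector `v`. -/
def blochState (v : EuclideanSpace ℝ (Fin 3)) : Matrix (Fin 2) (Fin 2) ℂ :=
  (1 / 2 : ℂ) • (1 + ∑ i, (v i : ℂ) • pauli i)

/-- The Bloch vector of a qubit state, with coordinates `Tr (ρ σ_i)`. -/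
def blochVector (ρ : Matrix (Fin 2) (Fin 2) ℂ) : EuclideanSpace ℝ (Fin 3) :=
  WithLp.toLp 2 fun i => ((ρ * pauli i).trace).re

end Teleportation

end

open scoped Matrix Kronecker ComplexOrder

namespace Teleportation

/-! Impossibility is a determinant count. Unfolding a protocol gives product Kraus operators `a j ⊗ₖ
B j` (`LOCC.exists_separable_kraus`); on the resource they act on the input qubit as `B j * S * A
j`, with `S` the Schmidt matrix and `A j` the reshaped row `a j` (`traceLeft_initialState`). Undoing
`U` yields Kraus operators of the identity channel, so the moduli of their determinants sum to 1.
Each modulus is at most `cos θ * sin θ / 4` times the product of the squared Frobenius norms of `A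
j` and `B j`. By the trace of the completeness relation these products sum to 8, whence `1 ≤ sin (2
* θ)`, which fails away from `π / 4`. The standard protocol is computed from the same Kraus form. -/

theorem traceLeft_sum {α β ι : Type} [Fintype α] (s : Finset ι)
    (ρ : ι → Matrix (α × β) (α × β) ℂ) :
    traceLeft (∑ i ∈ s, ρ i) = ∑ i ∈ s, traceLeft (ρ i) := by
  ext y y'
  simp only [traceLeft, Matrix.sum_apply]
  exact Finset.sum_comm

theorem sum_conjTranspose_mul_self_mul {ι l m n : Type} [Fintype ι] [Fintype l] [Fintype m]
    (T : ι → Matrix l m ℂ) (S : Matrix m n ℂ) :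
    ∑ j, (T j * S)ᴴ * (T j * S) = Sᴴ * (∑ j, (T j)ᴴ * T j) * S := by
  rw [Matrix.mul_sum, Matrix.sum_mul]
  refine Finset.sum_congr rfl fun j _ => ?_
  rw [Matrix.conjTranspose_mul]
  simp only [Matrix.mul_assoc]

theorem mul_sum_mul_conjTranspose {ι l m n : Type} [Fintype ι] [Fintype m] [Fintype n]
    (T : Matrix l m ℂ) (S : ι → Matrix m n ℂ) (ρ : Matrix n n ℂ) :
    T * (∑ k, S k * ρ * (S k)ᴴ) * Tᴴ = ∑ k, (T * S k) * ρ * (T * S k)ᴴ := by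
  rw [Matrix.mul_sum, Matrix.sum_mul]
  refine Finset.sum_congr rfl fun k _ => ?_
  rw [Matrix.conjTranspose_mul]
  simp only [Matrix.mul_assoc]

/-- The output of a protocol that ends with discarding Alice's register is given by Kraus operators
of product form, whose left factors are one-row matrices. -/
theorem LOCC.exists_separable_kraus {δ α β : Type} [Fintype δ] [Fintype α] [DecidableEq α]
    [Fintype β] [DecidableEq β] (P : LOCC δ α β) :
    ∃ (κ : Type) (_ : Fintype κ) (a : κ → Matrix Unit α ℂ) (B : κ → Matrix δ β ℂ),
      (∀ ρ, P.run ρ = ∑ j, traceLeft ((a j ⊗ₖ B j) * ρ * (a j ⊗ₖ B j)ᴴ)) ∧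
      ∑ j, (a j ⊗ₖ B j)ᴴ * (a j ⊗ₖ B j) = 1 := by
  rename_i iδ _ _ _ _
  induction P with
  | @done α _ _ i2 _ =>
    obtain rfl : iδ = i2 := Subsingleton.elim _ _
    -- Discarding Alice's register amounts to measuring it in the computational basis and forgetting
    -- the outcome.
    refine ⟨α, inferInstance, fun x => Matrix.of fun _ y => if x = y then 1 else 0,
      fun _ => 1, fun ρ => ?_, ?_⟩
    · ext y y'
      simp only [LOCC.run, traceLeft, Matrix.sum_apply]
      refine Finset.sum_congr rfl fun x _ => ?_
      simp [Matrix.mul_apply, Fintype.sum_prod_type, Matrix.one_apply, apply_ite]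
    · ext ⟨x, y⟩ ⟨x', y'⟩
      simp [Matrix.sum_apply, Matrix.mul_apply, Fintype.sum_prod_type, Matrix.one_apply, ite_and]
      split_ifs <;> simp_all
  | @alice α β _ _ _ _ ι κ α' _ _ _ _ K complete next ih =>
    choose κ' iκ' a B hrun hcomp using ih
    have h (i : ι) (j : κ' i) (k : κ) :
        (a i j * K i k) ⊗ₖ B i j = (a i j ⊗ₖ B i j) * (K i k ⊗ₖ (1 : Matrix β β ℂ)) := by
      rw [← Matrix.mul_kronecker_mul, Matrix.mul_one]
    -- A dependent sum, since the Kraus family of the continuation varies with the outcome `i`.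
    refine ⟨(i : ι) × (κ' i × κ), inferInstance, fun j => a j.1 j.2.1 * K j.1 j.2.2,
      fun j => B j.1 j.2.1, fun ρ => ?_, ?_⟩
    · simp only [LOCC.run, hrun, Fintype.sum_sigma, Fintype.sum_prod_type]
      refine Finset.sum_congr rfl fun i _ => Finset.sum_congr rfl fun j _ => ?_
      rw [mul_sum_mul_conjTranspose, traceLeft_sum]
      simp only [h]
    · simp only [Fintype.sum_sigma, Fintype.sum_prod_type_right, h,
        sum_conjTranspose_mul_self_mul, hcomp, Matrix.mul_one]
      simp only [Matrix.conjTranspose_kronecker, ← Matrix.mul_kronecker_mul,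
        Matrix.conjTranspose_one, Matrix.mul_one]
      rw [← Matrix.one_kronecker_one, ← complete]
      ext ⟨x, y⟩ ⟨x', y'⟩
      simp only [Matrix.sum_apply, Matrix.kroneckerMap_apply, Finset.sum_mul]
  | @bob α β _ _ _ _ ι κ β' _ _ _ _ K complete next ih =>
    choose κ' iκ' a B hrun hcomp using ih
    have h (i : ι) (j : κ' i) (k : κ) :
        a i j ⊗ₖ (B i j * K i k) = (a i j ⊗ₖ B i j) * ((1 : Matrix α α ℂ) ⊗ₖ K i k) := by
      rw [← Matrix.mul_kronecker_mul, Matrix.mul_one]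
    refine ⟨(i : ι) × (κ' i × κ), inferInstance, fun j => a j.1 j.2.1,
      fun j => B j.1 j.2.1 * K j.1 j.2.2, fun ρ => ?_, ?_⟩
    · simp only [LOCC.run, hrun, Fintype.sum_sigma, Fintype.sum_prod_type]
      refine Finset.sum_congr rfl fun i _ => Finset.sum_congr rfl fun j _ => ?_
      rw [mul_sum_mul_conjTranspose, traceLeft_sum]
      simp only [h]
    · simp only [Fintype.sum_sigma, Fintype.sum_prod_type_right, h,
        sum_conjTranspose_mul_self_mul, hcomp, Matrix.mul_one]
      simp only [Matrix.conjTranspose_kronecker, ← Matrix.mul_kronecker_mul,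
        Matrix.conjTranspose_one, Matrix.mul_one]
      rw [← Matrix.one_kronecker_one, ← complete]
      ext ⟨x, y⟩ ⟨x', y'⟩
      simp only [Matrix.sum_apply, Matrix.kroneckerMap_apply, Finset.mul_sum]

/-! ### The effective Kraus operators on the input qubit -/

/-- A row vector on `ℂ² ⊗ ℂ²` reshaped into an operator from the first to the second factor. -/
def rowOperator (a : Matrix Unit (Fin 2 × Fin 2) ℂ) : Matrix (Fin 2) (Fin 2) ℂ :=
  Matrix.of fun x q => a () (q, x)

/-- The Schmidt matrix of `resource θ`. -/
noncomputable def schmidt (θ : ℝ) : Matrix (Fin 2) (Fin 2) ℂ :=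
  Matrix.diagonal ![(Real.cos θ : ℂ), (Real.sin θ : ℂ)]

/-- Contracting `a` with an input `φ` and the basis vector `x` of Alice's half gives entry `x` of
`rowOperator a` applied to `φ`. The resource copies `x` to Bob with its Schmidt weight, and `B` then
acts. The remaining partial trace is over `Unit`, hence trivial. -/
theorem traceLeft_initialState (θ : ℝ) (a : Matrix Unit (Fin 2 × Fin 2) ℂ)
    (B ρ : Matrix (Fin 2) (Fin 2) ℂ) :
    traceLeft ((a ⊗ₖ B) * initialState (resource θ) ρ * (a ⊗ₖ B)ᴴ) =
      (B * schmidt θ * rowOperator a) * ρ * (B * schmidt θ * rowOperator a)ᴴ := by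
  ext y y'
  simp [traceLeft, initialState, ketbra, Matrix.vecMulVec_apply, resource, Matrix.mul_apply,
    Fintype.sum_prod_type, Fin.sum_univ_two, schmidt, rowOperator, Matrix.diagonal_apply]
  ring

theorem isDensity_ketbra {α : Type} [Fintype α] (φ : α → ℂ) (h : ∑ i, φ i * star (φ i) = 1) :
    IsDensity (ketbra φ) :=
  ⟨Matrix.posSemidef_vecMulVec_self_star φ, by
    simpa [ketbra, Matrix.trace, Matrix.vecMulVec_apply] using h⟩

/-! ### The determinant bound -/

/-- Kraus operators of the identity channel of a qubit are scalar, hence the moduli of their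
determinants sum to one. -/
theorem sum_norm_det_of_identity {κ : Type} [Fintype κ] (N : κ → Matrix (Fin 2) (Fin 2) ℂ)
    (h : ∀ ρ, IsDensity ρ → ∑ j, N j * ρ * (N j)ᴴ = ρ) : ∑ j, ‖(N j).det‖ = 1 := by
  have key (f : κ → ℂ) (hf : ∑ j, f j * star (f j) = 0) (j : κ) : f j = 0 := by
    have h1 : ∑ j, ‖f j‖ ^ 2 = 0 := by
      have h2 : ((∑ j, ‖f j‖ ^ 2 : ℝ) : ℂ) = 0 := by
        rw [← hf]; push_cast
        exact Finset.sum_congr rfl fun j _ => (Complex.mul_conj' (f j)).symm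
      exact_mod_cast h2
    have := (Finset.sum_eq_zero_iff_of_nonneg fun j _ => by positivity).1 h1 j (Finset.mem_univ j)
    simpa using this
  have h0 := h _ (isDensity_ketbra ![1, 0] (by simp))
  have h1 := h _ (isDensity_ketbra ![0, 1] (by simp))
  -- A superposition with rational amplitudes: its coherence `12 / 25` links the two diagonal
  -- entries of the `N j`.
  have h2 := h _ (isDensity_ketbra ![3 / 5, 4 / 5] (by
    simp [Fin.sum_univ_two, map_ofNat]; norm_num))
  have entry (φ : Fin 2 → ℂ) (hφ : ∑ j, N j * ketbra φ * (N j)ᴴ = ketbra φ) (x y : Fin 2) :=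
    congrFun (congrFun hφ x) y
  simp only [Matrix.sum_apply, Matrix.mul_apply, ketbra, Matrix.vecMulVec_apply,
    Fin.sum_univ_two, Matrix.conjTranspose_apply] at entry
  have e10 := key (fun j => N j 1 0) (by simpa using entry _ h0 1 1)
  have e01 := key (fun j => N j 0 1) (by simpa using entry _ h1 0 0)
  have s0 : ∑ j, N j 0 0 * star (N j 0 0) = 1 := by simpa using entry _ h0 0 0
  have s1 : ∑ j, N j 1 1 * star (N j 1 1) = 1 := by simpa using entry _ h1 1 1
  have s01 : ∑ j, N j 0 0 * star (N j 1 1) = 1 := by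
    have := entry _ h2 0 1
    simp [e10, e01] at this
    have h3 : (12 / 25 : ℂ) * ∑ j, N j 0 0 * star (N j 1 1) = 12 / 25 := by
      rw [Finset.mul_sum]
      calc _ = _ := Finset.sum_congr rfl fun j _ => by simp; ring
        _ = _ := this
        _ = _ := by norm_num
    linear_combination (25 / 12 : ℂ) * h3
  have s10 : ∑ j, N j 1 1 * star (N j 0 0) = 1 := by
    have := congrArg star s01
    simpa [mul_comm] using this
  -- The squared distance expands to `1 - 1 - 1 + 1 = 0`, so every `N j` is scalar.
  have e := key (fun j => N j 0 0 - N j 1 1) (by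
    simp only [star_sub, mul_sub, sub_mul, Finset.sum_sub_distrib, s0, s1, s01, s10]
    ring)
  have e' (j : κ) : ‖(N j).det‖ = ‖N j 0 0‖ ^ 2 := by
    rw [Matrix.det_fin_two, e10, e01, ← sub_eq_zero.1 (e j)]
    simp [sq]
  have h3 : ((∑ j, ‖N j 0 0‖ ^ 2 : ℝ) : ℂ) = 1 := by
    rw [← s0]; push_cast
    exact Finset.sum_congr rfl fun j _ => (Complex.mul_conj' _).symm
  simp only [e']
  exact_mod_cast h3

/-- The triangle inequality, then AM-GM on each of the two products. -/
theorem norm_det_fin_two_le (A : Matrix (Fin 2) (Fin 2) ℂ) :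
    ‖A.det‖ ≤ (∑ i, ∑ j, ‖A i j‖ ^ 2) / 2 := by
  rw [Matrix.det_fin_two]
  refine (norm_sub_le _ _).trans ?_
  simp only [norm_mul, Fin.sum_univ_two]
  nlinarith [sq_nonneg (‖A 0 0‖ - ‖A 1 1‖), sq_nonneg (‖A 0 1‖ - ‖A 1 0‖)]

theorem trace_kronecker_conjTranspose_mul (a : Matrix Unit (Fin 2 × Fin 2) ℂ)
    (B : Matrix (Fin 2) (Fin 2) ℂ) :
    ((a ⊗ₖ B)ᴴ * (a ⊗ₖ B)).trace =
      (((∑ i, ∑ j, ‖rowOperator a i j‖ ^ 2) * ∑ i, ∑ j, ‖B i j‖ ^ 2 : ℝ) : ℂ) := by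
  have h (z : ℂ) : (‖z‖ : ℂ) ^ 2 = star z * z := (Complex.conj_mul' z).symm
  rw [Matrix.conjTranspose_kronecker, ← Matrix.mul_kronecker_mul, Matrix.trace_kronecker]
  push_cast
  simp only [h, Matrix.trace, Matrix.diag, Matrix.mul_apply, Matrix.conjTranspose_apply,
    Fintype.sum_prod_type, Fin.sum_univ_two, rowOperator, Matrix.of_apply,
    Finset.univ_unique, Finset.sum_singleton]
  ring

theorem sin_two_mul_lt_one {θ : ℝ} (hθ : θ ∈ Set.Ioo 0 (Real.pi / 2)) (hne : θ ≠ Real.pi / 4) :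
    Real.sin (2 * θ) < 1 := by
  refine lt_of_le_of_ne (Real.sin_le_one _) fun h => hne ?_
  rw [Real.sin_eq_one_iff] at h
  obtain ⟨k, hk⟩ := h
  obtain ⟨h1, h2⟩ := hθ
  have hpi := Real.pi_pos
  have hk1 : (k : ℝ) < 1 := by nlinarith
  have hk2 : (-1 : ℝ) < k := by nlinarith
  have : k = 0 := by
    have : k < 1 := by exact_mod_cast hk1
    have : -1 < k := by exact_mod_cast hk2
    omega
  subst this
  simp at hk
  linarith

theorem one_le_sin_two_mul_of_isPerfectTeleportation {θ : ℝ} (hθ : θ ∈ Set.Ioo 0 (Real.pi / 2))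
    (P : LOCC (Fin 2) (Fin 2 × Fin 2) (Fin 2))
    (hP : IsPerfectTeleportation (inducedChannel P (resource θ))) : 1 ≤ Real.sin (2 * θ) := by
  obtain ⟨U, hU, hP⟩ := hP
  obtain ⟨κ, _, a, B, hrun, hcomp⟩ := P.exists_separable_kraus
  have hs : 0 < Real.sin θ := Real.sin_pos_of_mem_Ioo ⟨hθ.1, by linarith [hθ.2, Real.pi_pos]⟩
  have hc : 0 < Real.cos θ := Real.cos_pos_of_mem_Ioo ⟨by linarith [hθ.1, Real.pi_pos], hθ.2⟩
  have hUU : Uᴴ * U = 1 := Matrix.mem_unitaryGroup_iff'.1 hU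
  have hdetU : ‖(Uᴴ).det‖ = 1 := by
    have h := congrArg norm (congrArg Matrix.det hUU)
    rw [Matrix.det_mul, norm_mul, Matrix.det_one, norm_one, Matrix.det_conjTranspose] at h
    rw [Matrix.det_conjTranspose]
    rw [norm_star] at h ⊢
    nlinarith [norm_nonneg U.det]
  have hdet := sum_norm_det_of_identity
    (fun j => Uᴴ * (B j * schmidt θ * rowOperator (a j))) fun ρ hρ => by
      have h := hP ρ hρ
      simp only [inducedChannel, hrun, traceLeft_initialState] at h
      calc _ = Uᴴ * (∑ j, B j * schmidt θ * rowOperator (a j) * ρ *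
              (B j * schmidt θ * rowOperator (a j))ᴴ) * U := by
            rw [Finset.mul_sum, Finset.sum_mul]
            refine Finset.sum_congr rfl fun j _ => ?_
            rw [Matrix.conjTranspose_mul Uᴴ, Matrix.conjTranspose_conjTranspose]
            simp only [Matrix.mul_assoc]
        _ = (Uᴴ * U) * ρ * (Uᴴ * U) := by rw [h]; simp only [Matrix.mul_assoc]
        _ = ρ := by rw [hUU, Matrix.one_mul, Matrix.mul_one]
  -- 8 is the dimension of the three qubits `Q`, `A`, `B`.
  have htr : ∑ j, (∑ x, ∑ y, ‖rowOperator (a j) x y‖ ^ 2) * ∑ x, ∑ y, ‖B j x y‖ ^ 2 = 8 := by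
    have h := congrArg Matrix.trace hcomp
    rw [Matrix.trace_sum, Matrix.trace_one] at h
    simp only [trace_kronecker_conjTranspose_mul, ← Complex.ofReal_sum] at h
    exact Complex.ofReal_injective (h.trans (by norm_num [Fintype.card_prod]))
  have hdetS : ‖(schmidt θ).det‖ = Real.cos θ * Real.sin θ := by
    simp only [schmidt, Matrix.det_diagonal, Fin.prod_univ_two]
    simp [-Complex.ofReal_cos, -Complex.ofReal_sin, abs_of_pos hs, abs_of_pos hc]
  calc (1 : ℝ) = ∑ j, ‖(B j).det‖ * (Real.cos θ * Real.sin θ) * ‖(rowOperator (a j)).det‖ := by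
        rw [← hdet]
        simp only [Matrix.det_mul, norm_mul, hdetU, hdetS, one_mul]
    _ ≤ ∑ j, (Real.cos θ * Real.sin θ / 4) *
        ((∑ x, ∑ y, ‖rowOperator (a j) x y‖ ^ 2) * ∑ x, ∑ y, ‖B j x y‖ ^ 2) := by
        refine Finset.sum_le_sum fun j _ => ?_
        have h := mul_le_mul (norm_det_fin_two_le (rowOperator (a j))) (norm_det_fin_two_le (B j))
          (norm_nonneg _) (by positivity)
        have := mul_le_mul_of_nonneg_left h (mul_pos hc hs).le
        linarith
    _ = Real.sin (2 * θ) := by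
        rw [← Finset.mul_sum, htr, Real.sin_two_mul]; ring

/-! ### The standard protocol and the spheroid -/

/-- Up to sign and the factor `1 / √2`, the four Kraus operators are `S` twice and `S` with its
diagonal swapped twice. Their sum preserves the diagonal of the state, as `cos² + sin² = 1`, and
scales coherences by `2 * sin θ * cos θ`. -/
theorem standardProtocol_blochState (θ : ℝ) (v : EuclideanSpace ℝ (Fin 3)) :
    inducedChannel standardProtocol (resource θ) (blochState v) =
      blochState !₂[Real.sin (2 * θ) * v 0, Real.sin (2 * θ) * v 1, v 2] := by
  have hcs : (Real.cos θ : ℂ) ^ 2 + (Real.sin θ : ℂ) ^ 2 = 1 := by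
    exact_mod_cast Real.cos_sq_add_sin_sq θ
  have h2 : (Real.sqrt 2 : ℂ)⁻¹ * (Real.sqrt 2 : ℂ)⁻¹ = 1 / 2 := by
    rw [← mul_inv, ← Complex.ofReal_mul, Real.mul_self_sqrt (by norm_num)]; norm_num
  have hrun (ρ : Matrix (Fin 2) (Fin 2) ℂ) : inducedChannel standardProtocol (resource θ) ρ =
      ∑ m, (pauli4 m * schmidt θ * rowOperator (bellBra m)) * ρ *
        (pauli4 m * schmidt θ * rowOperator (bellBra m))ᴴ := by
    simp only [inducedChannel, standardProtocol, LOCC.run, ← traceLeft_initialState,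
      Finset.univ_unique, Finset.sum_singleton]
    refine Finset.sum_congr rfl fun m _ => ?_
    have h : bellBra m ⊗ₖ pauli4 m =
        ((1 : Matrix Unit Unit ℂ) ⊗ₖ pauli4 m) * (bellBra m ⊗ₖ (1 : Matrix (Fin 2) (Fin 2) ℂ)) := by
      rw [← Matrix.mul_kronecker_mul, Matrix.one_mul, Matrix.mul_one]
    rw [h, Matrix.conjTranspose_mul]
    simp only [Matrix.mul_assoc]
  -- The bra conjugates the Pauli entries; this matters only for `σ_y`, where it produces the sign
  -- in `p2`.
  have hrow (m : Fin 4) :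
      rowOperator (bellBra m) = (Real.sqrt 2 : ℂ)⁻¹ • (pauli4 m).map star := by
    ext x y
    simp [rowOperator, bellBra, bell, div_eq_mul_inv, mul_comm]
  have hscal (m : Fin 4) (ρ : Matrix (Fin 2) (Fin 2) ℂ) :
      (pauli4 m * schmidt θ * rowOperator (bellBra m)) * ρ *
        (pauli4 m * schmidt θ * rowOperator (bellBra m))ᴴ =
      (1 / 2 : ℂ) • ((pauli4 m * schmidt θ * (pauli4 m).map star) * ρ *
        (pauli4 m * schmidt θ * (pauli4 m).map star)ᴴ) := by
    rw [hrow, ← h2]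
    simp [Matrix.conjTranspose_smul, smul_smul]
  rw [hrun]
  simp only [hscal]
  rw [← Finset.smul_sum]
  simp only [Fin.sum_univ_four]
  have p0 : pauli4 0 * schmidt θ * (pauli4 0).map star = schmidt θ := by
    ext x y
    simp only [Matrix.mul_apply, Fin.sum_univ_two, Matrix.map_apply, schmidt,
      Matrix.diagonal_apply]
    fin_cases x <;> fin_cases y <;> simp [pauli4, pauli]
  have p1 : pauli4 1 * schmidt θ * (pauli4 1).map star = 
      Matrix.diagonal ![(Real.sin θ : ℂ), (Real.cos θ : ℂ)] := by
    ext x y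
    simp only [Matrix.mul_apply, Fin.sum_univ_two, Matrix.map_apply, schmidt,
      Matrix.diagonal_apply]
    fin_cases x <;> fin_cases y <;> simp [pauli4, pauli]
  have p2 : pauli4 2 * schmidt θ * (pauli4 2).map star = 
      -Matrix.diagonal ![(Real.sin θ : ℂ), (Real.cos θ : ℂ)] := by
    ext x y
    simp only [Matrix.mul_apply, Fin.sum_univ_two, Matrix.map_apply, schmidt,
      Matrix.diagonal_apply, Matrix.neg_apply]
    fin_cases x <;> fin_cases y <;> simp [pauli4, pauli, -Complex.ofReal_cos, -Complex.ofReal_sin]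
    · linear_combination (Real.sin θ : ℂ) * Complex.I_sq
    · linear_combination (Real.cos θ : ℂ) * Complex.I_sq
  have p3 : pauli4 3 * schmidt θ * (pauli4 3).map star = schmidt θ := by
    ext x y
    simp only [Matrix.mul_apply, Fin.sum_univ_two, Matrix.map_apply, schmidt,
      Matrix.diagonal_apply]
    fin_cases x <;> fin_cases y <;> simp [pauli4, pauli]
  rw [p0, p1, p2, p3, Real.sin_two_mul]
  ext x y
  fin_cases x <;> fin_cases y <;>
    simp [blochState, pauli, schmidt, Matrix.mul_apply, Fin.sum_univ_succ,
      -Complex.ofReal_cos, -Complex.ofReal_sin]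
  · linear_combination (1 + (v 2 : ℂ)) * hcs
  · ring
  · ring
  · linear_combination (1 - (v 2 : ℂ)) * hcs

theorem blochVector_blochState (v : EuclideanSpace ℝ (Fin 3)) : blochVector (blochState v) = v := by
  ext i
  fin_cases i <;>
    simp [blochVector, blochState, pauli, Matrix.trace, Matrix.mul_apply, Fin.sum_univ_succ] <;>
    ring

theorem mem_closedBall_fin_three (v : EuclideanSpace ℝ (Fin 3)) :
    v ∈ Metric.closedBall (0 : EuclideanSpace ℝ (Fin 3)) 1 ↔ v 0 ^ 2 + v 1 ^ 2 + v 2 ^ 2 ≤ 1 := by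
  rw [mem_closedBall_zero_iff, EuclideanSpace.norm_eq, Real.sqrt_le_one]
  simp [Fin.sum_univ_three]

theorem image_closedBall_diag {s : ℝ} (hs : s ≠ 0) :
    (fun v : EuclideanSpace ℝ (Fin 3) => !₂[s * v 0, s * v 1, v 2]) ''
        Metric.closedBall (0 : EuclideanSpace ℝ (Fin 3)) 1 =
      {w : EuclideanSpace ℝ (Fin 3) | w 0 ^ 2 / s ^ 2 + w 1 ^ 2 / s ^ 2 + w 2 ^ 2 ≤ 1} := by
  ext w
  simp only [Set.mem_image, mem_closedBall_fin_three, Set.mem_ofPred_eq]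
  constructor
  · rintro ⟨v, hv, rfl⟩
    simpa [mul_pow, mul_div_cancel_left₀, hs] using hv
  · intro hw
    refine ⟨!₂[w 0 / s, w 1 / s, w 2], by simpa [div_pow] using hw, ?_⟩
    ext i
    fin_cases i <;> simp [mul_div_cancel₀, hs]

end Teleportation

theorem mainTheorem7 (θ : ℝ) (hθ : θ ∈ Set.Ioo 0 (Real.pi / 2)) (hne : θ ≠ Real.pi / 4) :
    (¬ ∃ P : Teleportation.LOCC (Fin 2) (Fin 2 × Fin 2) (Fin 2),
      Teleportation.IsPerfectTeleportation
        (Teleportation.inducedChannel P (Teleportation.resource θ))) ∧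
    (∀ v ∈ Metric.closedBall (0 : EuclideanSpace ℝ (Fin 3)) 1,
      Teleportation.inducedChannel Teleportation.standardProtocol (Teleportation.resource θ)
          (Teleportation.blochState v) =
        Teleportation.blochState
          !₂[Real.sin (2 * θ) * v 0, Real.sin (2 * θ) * v 1, v 2]) ∧
    (fun v => Teleportation.blochVector
        (Teleportation.inducedChannel Teleportation.standardProtocol (Teleportation.resource θ)
          (Teleportation.blochState v))) '' Metric.closedBall (0 : EuclideanSpace ℝ (Fin 3)) 1 =
      {w : EuclideanSpace ℝ (Fin 3) |
        w 0 ^ 2 / Real.sin (2 * θ) ^ 2 + w 1 ^ 2 / Real.sin (2 * θ) ^ 2 + w 2 ^ 2 ≤ 1} ∧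
    0 < Real.sin (2 * θ) ∧ Real.sin (2 * θ) < 1 := by
  have hs : 0 < Real.sin (2 * θ) :=
    Real.sin_pos_of_mem_Ioo ⟨by linarith [hθ.1], by linarith [hθ.2]⟩
  have hlt := Teleportation.sin_two_mul_lt_one hθ hne
  refine ⟨fun ⟨P, hP⟩ => ?_, fun v _ => Teleportation.standardProtocol_blochState θ v, ?_, hs, hlt⟩
  · exact hlt.not_ge (Teleportation.one_le_sin_two_mul_of_isPerfectTeleportation hθ P hP)
  · simp only [Teleportation.standardProtocol_blochState, Teleportation.blochVector_blochState]
    exact Teleportation.image_closedBall_diag hs.ne'
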